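/- Let $k \ge 1$ be an integer and let $\mathcal{H}$ be the family of all (open or closed) half-planes in $\mathbb{R}^2$. A $k$-coloring of a finite set $P \subset \mathbb{R}^2$ is a function $\chi : P \to \{1,\dots,k\}$, and a half-plane $h$ is polychromatic for $\chi$ if $h \cap P$ contains a point of each of the $k$ colors. Let $f_{\mathcal{H}}(k)$ be the minimum number $f$ such that every finite set $P \subset \mathbb{R}^2$ has a $k$-coloring for which every half-plane containing at least $f$ points of $P$ is polychromatic. Then this minimum exists and $f_{\mathcal{H}}(k) = 2k-1$. Moreover, for every integer $n \ge 2k-1$ there is a set $P \subset \mathbb{R}^2$ of exactly $n$ points and a subset $\Gamma \subseteq P$ of exactly $2k-1$ points lying on the parabola arc $\{(x,y) : y = x^2,\ -1 < x < 1\}$ such that, for every $k$-coloring of $P$, there is an open half-plane that contains exactly $2k-2$ points of $P$, all of them belonging to $\Gamma$, and that is not polychromatic. -/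

import Mathlib

namespace PolychromaticColoring

/-- A region `R` is polychromatic with respect to the `k`-coloring `χ` of the finite point set `P`
if it contains a point of `P` from each of the `k` color classes. -/
def IsPolychromatic {X : Type*} {P : Finset X} {k : ℕ} (χ : {p : X // p ∈ P} → Fin k)
    (R : Set X) : Prop :=
  ∀ i : Fin k, ∃ p : {p : X // p ∈ P}, (p : X) ∈ R ∧ χ p = i

/-- Every finite point set `P` can be `k`-colored so that every range `R ∈ 𝓡` containing
at least `f` points of `P` is polychromatic. -/
def IsThreshold {X : Type*} (𝓡 : Set (Set X)) (k f : ℕ) : Prop :=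
  ∀ P : Finset X, ∃ χ : {p : X // p ∈ P} → Fin k,
    ∀ R ∈ 𝓡, f ≤ ((P : Set X) ∩ R).ncard → IsPolychromatic χ R

/-- `f_𝓡(k) = m`: the minimum `f` that is a threshold for `𝓡` and `k` exists and equals `m`. -/
def PolychromaticNumberEq {X : Type*} (𝓡 : Set (Set X)) (k m : ℕ) : Prop :=
  IsLeast {f : ℕ | IsThreshold 𝓡 k f} m

/-- The Euclidean plane. -/
abbrev Plane : Type := EuclideanSpace ℝ (Fin 2)

/-- The open half-planes `{x | ⟨a, x⟩ > c}` with `a ≠ 0`. -/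
def openHalfPlanes : Set (Set Plane) :=
  {h | ∃ (a : Plane) (c : ℝ), a ≠ 0 ∧ h = {x : Plane | c < inner ℝ a x}}

/-- The closed half-planes `{x | ⟨a, x⟩ ≥ c}` with `a ≠ 0`. -/
def closedHalfPlanes : Set (Set Plane) :=
  {h | ∃ (a : Plane) (c : ℝ), a ≠ 0 ∧ h = {x : Plane | c ≤ inner ℝ a x}}

/-- The family of all half-planes, open or closed. -/
def halfPlanes : Set (Set Plane) := openHalfPlanes ∪ closedHalfPlanes

end PolychromaticColoring

/-!
Upper bound: colour greedily. For `m ≥ 1`, let `N` be a minimal set of extreme points of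
`convexHull P` that meets every hemispace containing at least `m` points of `P`. Then a hemispace
`h` with exactly `m` points contains at most two points of `N`. Indeed, three extreme points in `h`
have one in the middle: no barycentric coordinate with respect to the three vanishes on the convex
set `convexHull P \ h`, so a single one is negative throughout it, and a hemispace which contains
the corresponding vertex but neither of the other two cuts off of `convexHull P` only a part of
`h`. A hemispace that forces this vertex into `N` would thus have fewer than `m` points.
Hence each colour class costs a half-plane at most two points.

Lower bound: among `2 k - 1` points of a parabola some colour is used at most once, and an open
half-plane bounded by a tangent contains all of these points except the point of tangency.
-/

namespace PolychromaticColoring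

section Hemispaces

variable {𝕜 E ι : Type*} [Field 𝕜] [LinearOrder 𝕜] [IsStrictOrderedRing 𝕜]
  [AddCommGroup E] [Module 𝕜 E] {A B K h : Set E}

variable (𝕜) in
/-- A hemispace is a convex set whose complement is convex. Hemispaces generalize half-planes so
that the points of a finite set in a half-plane can be removed one at a time, including several
points on one line parallel to its boundary. -/
def IsHemispace (h : Set E) : Prop :=
  Convex 𝕜 h ∧ Convex 𝕜 hᶜ

-- As in Radon's theorem, the positive and the negative terms have the same centre of mass.
theorem inter_nonempty_of_sum_smul_eq_zero [Fintype ι] (hA : Convex 𝕜 A) (hB : Convex 𝕜 B)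
    {w : ι → 𝕜} {z : ι → E} (hw : ∑ i, w i = 0) (hz : ∑ i, w i • z i = 0) (hw0 : w ≠ 0)
    (hpos : ∀ i, 0 < w i → z i ∈ A) (hneg : ∀ i, w i < 0 → z i ∈ B) : (A ∩ B).Nonempty := by
  obtain ⟨i₀, hi₀⟩ := Function.ne_iff.1 hw0
  obtain ⟨i, -, hi⟩ :=
    Finset.exists_pos_of_sum_zero_of_exists_nonzero w hw ⟨i₀, Finset.mem_univ i₀, hi₀⟩
  have hsum : ∑ i, (w i)⁺ = ∑ i, (w i)⁻ := by
    rw [← sub_eq_zero, ← Finset.sum_sub_distrib]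
    simpa only [posPart_sub_negPart] using hw
  have hcombo : ∑ i, (w i)⁺ • z i = ∑ i, (w i)⁻ • z i := by
    rw [← sub_eq_zero, ← Finset.sum_sub_distrib]
    simpa only [← sub_smul, posPart_sub_negPart] using hz
  have hW : 0 < ∑ i, (w i)⁺ :=
    Finset.sum_pos' (fun _ _ => posPart_nonneg _) ⟨i, Finset.mem_univ i, posPart_pos hi⟩
  have centerMass_mem {C : Set E} (hC : Convex 𝕜 C) {u : ι → 𝕜} (hu : ∀ i, 0 ≤ u i)
      (hu0 : 0 < ∑ i, u i) (hzC : ∀ i, u i ≠ 0 → z i ∈ C) : Finset.univ.centerMass u z ∈ C := by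
    rw [← Finset.centerMass_filter_ne_zero]
    exact hC.centerMass_mem (fun i _ => hu i) (by rwa [Finset.sum_filter_ne_zero])
      fun i hi => hzC i (Finset.mem_filter.1 hi).2
  refine ⟨Finset.univ.centerMass (fun i => (w i)⁺) z, ?_, ?_⟩
  · exact centerMass_mem hA (fun i => posPart_nonneg _) hW
      fun i hi => hpos i (posPart_pos_iff.1 ((posPart_nonneg _).lt_of_ne' hi))
  · rw [Finset.centerMass, hsum, hcombo]
    exact centerMass_mem hB (fun i => negPart_nonneg _) (hsum ▸ hW)
      fun i hi => hneg i (negPart_pos_iff.1 ((negPart_nonneg _).lt_of_ne' hi))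

theorem inter_nonempty_of_mem_of_coord [Finite ι] (hA : Convex 𝕜 A) (hB : Convex 𝕜 B)
    (b : AffineBasis ι 𝕜 E) {x : E} (hx : x ∈ B) (hpos : ∀ i, 0 < b.coord i x → b i ∈ A)
    (hneg : ∀ i, b.coord i x < 0 → b i ∈ B) : (A ∩ B).Nonempty := by
  have := Fintype.ofFinite ι
  refine inter_nonempty_of_sum_smul_eq_zero (ι := Option ι) hA hB
    (w := fun o => o.elim (-1) fun i => b.coord i x) (z := fun o => o.elim x b) ?_ ?_ ?_ ?_ ?_
  · simp [Fintype.sum_option]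
  · simp [Fintype.sum_option]
  · exact fun h0 => by simpa using congrFun h0 none
  · rintro (_ | i) hi
    exacts [absurd hi (by simp), hpos i hi]
  · rintro (_ | i) hi
    exacts [hx, hneg i hi]

theorem affineIndependent_of_mem_extremePoints {v : Fin 3 → E} (hinj : Function.Injective v)
    (hv : ∀ i, v i ∈ K.extremePoints 𝕜) : AffineIndependent 𝕜 v := by
  have not_wbtw {i j l : Fin 3} (hij : i ≠ j) (hlj : l ≠ j) : ¬ Wbtw 𝕜 (v i) (v j) (v l) :=
    fun hw => by
      rcases (mem_extremePoints_iff_forall_segment.1 (hv j)).2 _ (hv i).1 _ (hv l).1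
        (mem_segment_iff_wbtw.2 hw) with h | h
      exacts [hij (hinj h), hlj (hinj h)]
  rw [show v = ![v 0, v 1, v 2] by ext i; fin_cases i <;> rfl,
    affineIndependent_iff_not_collinear_set]
  intro hcol
  rcases hcol.wbtw_or_wbtw_or_wbtw with hw | hw | hw
  exacts [not_wbtw (by decide) (by decide) hw, not_wbtw (by decide) (by decide) hw,
    not_wbtw (by decide) (by decide) hw]

section Triangle

variable {b : AffineBasis (Fin 3) 𝕜 E}

-- If only `b j` had a positive coordinate, then `b j` would be a convex combination of `x` and the
-- other two vertices, contradicting its extremality.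
theorem exists_coord_neg_and_forall_ne_coord_pos (hK : Convex 𝕜 K) (hh : Convex 𝕜 h)
    (hb : ∀ i, b i ∈ K.extremePoints 𝕜) (hbh : ∀ i, b i ∈ h) {x : E} (hx : x ∈ K \ h) :
    ∃ i, b.coord i x < 0 ∧ ∀ j ≠ i, 0 < b.coord j x := by
  obtain ⟨i, hi⟩ : ∃ i, b.coord i x < 0 := by
    by_contra! hnonneg
    exact (inter_nonempty_of_mem_of_coord hh (convex_singleton x) b rfl (fun i _ => hbh i)
      fun i hi => absurd hi (hnonneg i).not_gt).ne_empty
      (Set.inter_singleton_eq_empty.2 hx.2)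
  obtain ⟨j, hj⟩ : ∃ j, 0 < b.coord j x := by
    obtain ⟨j, -, hj⟩ := Finset.exists_lt_of_sum_lt (s := .univ) (f := fun _ : Fin 3 => (0 : 𝕜))
      (g := fun j => b.coord j x) (by simp)
    exact ⟨j, hj⟩
  obtain ⟨l, hlj, hl⟩ : ∃ l ≠ j, 0 < b.coord l x := by
    by_contra! honly
    have hconv : Convex 𝕜 (K \ {b j}) := (hK.mem_extremePoints_iff_convex_sdiff.1 (hb j)).2
    refine (inter_nonempty_of_mem_of_coord (convex_singleton (b j)) hconv b
      ⟨hx.1, fun hxj => hx.2 (hxj ▸ hbh j)⟩ (fun l hl => ?_) fun l hl => ⟨(hb l).1, ?_⟩).ne_empty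
      (Set.inter_sdiff_self _ _)
    · exact congrArg b (by_contra fun hlj => (honly l hlj).not_gt hl)
    · exact b.ind.injective.ne (by rintro rfl; exact hl.not_gt hj)
  refine ⟨i, hi, fun m hm => ?_⟩
  have hij : j ≠ i := by rintro rfl; exact hi.not_gt hj
  have hil : l ≠ i := by rintro rfl; exact hi.not_gt hl
  obtain rfl | rfl : m = j ∨ m = l := by omega
  exacts [hj, hl]

-- No coordinate vanishes on the convex set `K \ h`, so each has a constant sign there.
theorem coord_neg_of_coord_neg (hK : Convex 𝕜 K) (hh : IsHemispace 𝕜 h)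
    (hb : ∀ i, b i ∈ K.extremePoints 𝕜) (hbh : ∀ i, b i ∈ h) {x y : E} (hx : x ∈ K \ h)
    (hy : y ∈ K \ h) {i : Fin 3} (hi : b.coord i x < 0) : b.coord i y < 0 := by
  by_contra! hiy
  obtain ⟨z, hz, hiz⟩ : (0 : 𝕜) ∈ b.coord i '' (K \ h) :=
    ((hK.inter hh.2).affine_image (b.coord i)).ordConnected.out (Set.mem_image_of_mem _ hx)
      (Set.mem_image_of_mem _ hy) ⟨hi.le, hiy⟩
  obtain ⟨j, hj, hpos⟩ := exists_coord_neg_and_forall_ne_coord_pos hK hh.1 hb hbh hz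
  obtain rfl | hij := eq_or_ne i j
  exacts [hj.ne hiz, (hpos i hij).ne' hiz]

end Triangle

-- The vertex `v i` in the middle is the one whose barycentric coordinate is negative on `K \ h`.
theorem exists_forall_isHemispace_inter_subset (hE : Module.finrank 𝕜 E = 2) (hK : Convex 𝕜 K)
    (hh : IsHemispace 𝕜 h) {v : Fin 3 → E} (hinj : Function.Injective v)
    (hv : ∀ i, v i ∈ K.extremePoints 𝕜) (hvh : ∀ i, v i ∈ h) :
    ∃ i, ∀ g, IsHemispace 𝕜 g → v i ∈ g → (∀ j ≠ i, v j ∉ g) → K ∩ g ⊆ h := by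
  obtain ⟨b, rfl⟩ : ∃ b : AffineBasis (Fin 3) 𝕜 E, ⇑b = v := by
    have hind := affineIndependent_of_mem_extremePoints hinj hv
    have : FiniteDimensional 𝕜 E := .of_finrank_pos (by omega)
    exact ⟨⟨v, hind, hind.affineSpan_eq_top_iff_card_eq_finrank_add_one.2 (by simp [hE])⟩, rfl⟩
  obtain hempty | ⟨x, hx⟩ := (K \ h).eq_empty_or_nonempty
  · exact ⟨0, fun g _ _ _ => Set.inter_subset_left.trans (Set.sdiff_eq_empty.1 hempty)⟩
  obtain ⟨i, hi, -⟩ := exists_coord_neg_and_forall_ne_coord_pos hK hh.1 hv hvh hx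
  refine ⟨i, fun g hg hig hjg y hy => by_contra fun hyh => ?_⟩
  have hyi : b.coord i y < 0 := coord_neg_of_coord_neg hK hh hv hvh hx ⟨hy.1, hyh⟩ hi
  refine (inter_nonempty_of_mem_of_coord hg.2 hg.1 b hy.2 (fun j hj => ?_) fun j hj => ?_).ne_empty
    (Set.compl_inter_self g)
  · exact hjg j (by rintro rfl; exact hyi.not_gt hj)
  · obtain ⟨l, -, hpos⟩ := exists_coord_neg_and_forall_ne_coord_pos hK hh.1 hv hvh ⟨hy.1, hyh⟩
    obtain rfl : i = l := by_contra fun hil => (hpos i hil).not_gt hyi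
    obtain rfl : j = i := by_contra fun hji => (hpos j hji).not_gt hj
    exact hig

end Hemispaces

section HittingSets

theorem extremePoints_inter_nonempty {E : Type*} [AddCommGroup E] [Module ℝ E]
    [TopologicalSpace E] [T2Space E] [IsTopologicalAddGroup E] [ContinuousSMul ℝ E]
    [LocallyConvexSpace ℝ E] {s h : Set E} (hs : s.Finite) (hh : Convex ℝ hᶜ)
    (hsh : (s ∩ h).Nonempty) : ((convexHull ℝ s).extremePoints ℝ ∩ h).Nonempty := by
  rw [← Set.not_disjoint_iff_nonempty_inter, ← Set.subset_compl_iff_disjoint_right] at hsh ⊢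
  refine fun hext => hsh ((subset_convexHull ℝ s).trans ?_)
  have hfin : ((convexHull ℝ s).extremePoints ℝ).Finite :=
    hs.subset extremePoints_convexHull_subset
  rw [← closure_convexHull_extremePoints (hs.isCompact_convexHull ℝ) (convex_convexHull ℝ s),
    (hfin.isClosed_convexHull ℝ).closure_eq]
  exact convexHull_min hext hh

theorem exists_minimal_hitting_set {X : Type*} {𝓡 : Set (Set X)} {V : Finset X}
    (hV : ∀ R ∈ 𝓡, ((V : Set X) ∩ R).Nonempty) :
    ∃ N ⊆ V, (∀ R ∈ 𝓡, ((N : Set X) ∩ R).Nonempty) ∧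
      ∀ q ∈ N, ∃ R ∈ 𝓡, (N : Set X) ∩ R = {q} := by
  classical
  obtain ⟨N, hNV, hN⟩ := exists_minimal_le_of_wellFoundedLT
    (fun N : Finset X => ∀ R ∈ 𝓡, ((N : Set X) ∩ R).Nonempty) V hV
  refine ⟨N, hNV, hN.prop, fun q hq => ?_⟩
  by_contra! hprivate
  refine (Finset.erase_ssubset hq).not_ge (hN.le_of_le (fun R hR => ?_) (Finset.erase_subset q N))
  by_contra hmiss
  refine hprivate R hR (Set.eq_singleton_iff_nonempty_unique_mem.2 ⟨hN.prop R hR, fun p hp => ?_⟩)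
  by_contra hpq
  exact hmiss ⟨p, Finset.mem_coe.2 (Finset.mem_erase.2 ⟨hpq, hp.1⟩), hp.2⟩

theorem ncard_inter_le_two {𝕜 E : Type*} [Field 𝕜] [LinearOrder 𝕜] [IsStrictOrderedRing 𝕜]
    [AddCommGroup E] [Module 𝕜 E] (hE : Module.finrank 𝕜 E = 2) {P N : Finset E}
    (hN : ∀ p ∈ N, p ∈ (convexHull 𝕜 (P : Set E)).extremePoints 𝕜) {h : Set E}
    (hh : IsHemispace 𝕜 h)
    (hprivate : ∀ q ∈ N, ∃ R, IsHemispace 𝕜 R ∧ (N : Set E) ∩ R = {q} ∧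
      ((P : Set E) ∩ h).ncard ≤ ((P : Set E) ∩ R).ncard) :
    ((N : Set E) ∩ h).ncard ≤ 2 := by
  by_contra! h3
  obtain ⟨v, hinj, hv⟩ : ∃ v : Fin 3 → E, Function.Injective v ∧ ∀ i, v i ∈ (N : Set E) ∩ h := by
    obtain ⟨x, hx, y, hy, z, hz, hxy, hxz, hyz⟩ :=
      (Set.two_lt_ncard (N.finite_toSet.inter_of_left h)).1 h3
    refine ⟨![x, y, z], ?_, fun i => by fin_cases i <;> assumption⟩
    simp [Function.Injective, Fin.forall_fin_succ, hxy, hxz, hyz, hxy.symm, hxz.symm, hyz.symm]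
  have hext (i) : v i ∈ (convexHull 𝕜 (P : Set E)).extremePoints 𝕜 := hN _ (hv i).1
  choose R hR hNR hcard using fun i => hprivate (v i) (hv i).1
  have hvR (i) : v i ∈ R i := ((hNR i).ge rfl).2
  have hvR' {i j} (hij : j ≠ i) : v j ∉ R i := fun hj =>
    hij (hinj ((hNR i).le ⟨(hv j).1, hj⟩))
  obtain ⟨i, hi⟩ := exists_forall_isHemispace_inter_subset hE (convex_convexHull 𝕜 _) hh hinj hext
    fun i => (hv i).2
  obtain ⟨j, hij⟩ := exists_ne i
  have hsub : (P : Set E) ∩ R i ⊆ (P : Set E) ∩ h := fun x hx => ⟨hx.1,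
    hi (R i) (hR i) (hvR i) (fun _ => hvR') ⟨subset_convexHull 𝕜 _ hx.1, hx.2⟩⟩
  refine (hcard i).not_gt (Set.ncard_lt_ncard ((Set.ssubset_iff_of_subset hsub).2
    ⟨v j, ⟨extremePoints_convexHull_subset (hext j), (hv j).2⟩, fun hj => hvR' hij hj.2⟩)
    (P.finite_toSet.inter_of_left h))

theorem exists_sparse_hitting_set {E : Type*} [AddCommGroup E] [Module ℝ E]
    [TopologicalSpace E] [T2Space E] [IsTopologicalAddGroup E] [ContinuousSMul ℝ E]
    [LocallyConvexSpace ℝ E] (hE : Module.finrank ℝ E = 2) (P : Finset E) {m : ℕ} (hm : 1 ≤ m) :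
    ∃ N ⊆ P, ∀ h, IsHemispace ℝ h →
      (m ≤ ((P : Set E) ∩ h).ncard → ((N : Set E) ∩ h).Nonempty) ∧
      (((P : Set E) ∩ h).ncard = m → ((N : Set E) ∩ h).ncard ≤ 2) := by
  classical
  obtain ⟨N, hNV, hhit, hprivate⟩ := exists_minimal_hitting_set
    (𝓡 := {h | IsHemispace ℝ h ∧ m ≤ ((P : Set E) ∩ h).ncard})
    (V := {p ∈ P | p ∈ (convexHull ℝ (P : Set E)).extremePoints ℝ}) fun h hh => by
      obtain ⟨x, hx, hxh⟩ := extremePoints_inter_nonempty P.finite_toSet hh.1.2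
        (Set.nonempty_of_ncard_ne_zero (Nat.one_le_iff_ne_zero.1 (hm.trans hh.2)))
      exact ⟨x, Finset.mem_coe.2 (Finset.mem_filter.2
        ⟨extremePoints_convexHull_subset hx, hx⟩), hxh⟩
  refine ⟨N, hNV.trans (Finset.filter_subset _ P), fun h hh => ⟨fun hmh => hhit h ⟨hh, hmh⟩,
    fun hmh => ncard_inter_le_two hE (fun p hp => (Finset.mem_filter.1 (hNV hp)).2) hh
      fun q hq => ?_⟩⟩
  obtain ⟨R, ⟨hR, hmR⟩, hNR⟩ := hprivate q hq
  exact ⟨R, hR, hNR, hmh.trans_le hmR⟩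

end HittingSets

section Trimming

instance prodLex_posSMulStrictMono {𝕜 α β : Type*} [Zero 𝕜] [Preorder 𝕜] [PartialOrder α]
    [Preorder β] [SMul 𝕜 α] [SMul 𝕜 β] [PosSMulStrictMono 𝕜 α] [PosSMulStrictMono 𝕜 β] :
    PosSMulStrictMono 𝕜 (α ×ₗ β) where
  smul_lt_smul_of_pos_left c hc x y hxy := by
    rw [Prod.Lex.lt_iff] at hxy ⊢
    exact hxy.imp (smul_lt_smul_of_pos_left · hc)
      (And.imp (congrArg (c • ·)) (smul_lt_smul_of_pos_left · hc))

theorem exists_ncard_inter_preimage_Ici_eq {X Γ : Type*} [LinearOrder Γ] {κ : X → Γ}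
    (hκ : Function.Injective κ) {m : ℕ} (hm : 1 ≤ m) {Q : Finset X} (hQ : m ≤ Q.card) :
    ∃ t ∈ Q, ((Q : Set X) ∩ κ ⁻¹' Set.Ici (κ t)).ncard = m := by
  classical
  induction Q using Finset.induction_on_min_value κ with
  | empty => simp at hQ; omega
  | insert q Q hq hmin ih =>
    obtain hlt | rfl : m ≤ Q.card ∨ m = Q.card + 1 := by
      rw [Finset.card_insert_of_notMem hq] at hQ; omega
    · obtain ⟨t, ht, htm⟩ := ih hlt
      refine ⟨t, Finset.mem_insert_of_mem ht, htm ▸ congrArg _ ?_⟩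
      have hqt : ¬ κ t ≤ κ q := fun h => hq (hκ (h.antisymm (hmin t ht)) ▸ ht)
      rw [Finset.coe_insert, Set.insert_inter_of_notMem (by exact hqt)]
    · refine ⟨q, Finset.mem_insert_self q Q, ?_⟩
      have hsub : (↑(insert q Q) : Set X) ⊆ κ ⁻¹' Set.Ici (κ q) :=
        (Finset.forall_mem_insert _ _ _).2 ⟨le_rfl, hmin⟩
      rw [Set.inter_eq_left.2 hsub, Set.ncard_coe_finset,
        Finset.card_insert_of_notMem hq]

section OrderedModule

variable {𝕜 E Γ : Type*} [Field 𝕜] [LinearOrder 𝕜] [AddCommGroup E] [Module 𝕜 E]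
  [AddCommGroup Γ] [LinearOrder Γ] [IsOrderedAddMonoid Γ] [Module 𝕜 Γ] [PosSMulStrictMono 𝕜 Γ]

theorem isHemispace_preimage_Ici (κ : E →ₗ[𝕜] Γ) (c : Γ) : IsHemispace 𝕜 (κ ⁻¹' Set.Ici c) := by
  refine ⟨(convex_Ici c).linear_preimage κ, ?_⟩
  rw [← Set.preimage_compl, Set.compl_Ici]
  exact (convex_Iio c).linear_preimage κ

theorem exists_isHemispace_ncard_inter_eq {κ : E →ₗ[𝕜] Γ} (hκ : Function.Injective κ) {U : Set Γ}
    (hU : IsUpperSet U) {P : Finset E} {m : ℕ} (hm : 1 ≤ m)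
    (hP : m ≤ ((P : Set E) ∩ κ ⁻¹' U).ncard) :
    ∃ h, IsHemispace 𝕜 h ∧ (P : Set E) ∩ h ⊆ κ ⁻¹' U ∧ ((P : Set E) ∩ h).ncard = m := by
  obtain ⟨Q, hQ⟩ := (P.finite_toSet.inter_of_left (κ ⁻¹' U)).exists_finset_coe
  rw [← hQ, Set.ncard_coe_finset] at hP
  obtain ⟨t, ht, htm⟩ := exists_ncard_inter_preimage_Ici_eq hκ hm hP
  have htU : κ t ∈ U := (hQ.le ht).2
  refine ⟨_, isHemispace_preimage_Ici κ (κ t), fun x hx => hU hx.2 htU, ?_⟩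
  rw [← htm, hQ, Set.inter_assoc, Set.inter_eq_right.2 (Set.preimage_mono (hU.Ici_subset htU))]

end OrderedModule

-- Breaking the ties of `⟪a, ·⟫` by the coordinates separates the points of the plane.
theorem exists_injective_isUpperSet_preimage_eq {R : Set Plane} (hR : R ∈ halfPlanes) :
    ∃ κ : Plane →ₗ[ℝ] ℝ ×ₗ (ℝ ×ₗ ℝ), Function.Injective κ ∧
      ∃ U : Set (ℝ ×ₗ (ℝ ×ₗ ℝ)), IsUpperSet U ∧ κ ⁻¹' U = R := by
  obtain ⟨a, V, hV, rfl⟩ : ∃ (a : Plane) (V : Set ℝ), IsUpperSet V ∧ inner ℝ a ⁻¹' V = R := by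
    rcases hR with ⟨a, c, -, rfl⟩ | ⟨a, c, -, rfl⟩
    exacts [⟨a, _, isUpperSet_Ioi c, rfl⟩, ⟨a, _, isUpperSet_Ici c, rfl⟩]
  let κ : Plane →ₗ[ℝ] ℝ ×ₗ (ℝ ×ₗ ℝ) := (toLexLinearEquiv ℝ (ℝ × (ℝ ×ₗ ℝ))).toLinearMap ∘ₗ
    (innerₗ Plane a).prod ((toLexLinearEquiv ℝ (ℝ × ℝ)).toLinearMap ∘ₗ
      (EuclideanSpace.projₗ (0 : Fin 2)).prod (EuclideanSpace.projₗ (1 : Fin 2)))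
  refine ⟨κ, fun x y hxy => ?_, (fun z => (ofLex z).1) ⁻¹' V,
    hV.preimage Prod.Lex.monotone_fst_ofLex, rfl⟩
  have hcoord : x 0 = y 0 ∧ x 1 = y 1 := by
    have := congrArg (fun z => ofLex (ofLex z).2) hxy
    simpa [κ] using this
  ext i
  fin_cases i
  exacts [hcoord.1, hcoord.2]

theorem exists_isHemispace_inter_subset_halfPlane {R : Set Plane} (hR : R ∈ halfPlanes)
    {P : Finset Plane} {m : ℕ} (hm : 1 ≤ m) (hP : m ≤ ((P : Set Plane) ∩ R).ncard) :
    ∃ h, IsHemispace ℝ h ∧ (P : Set Plane) ∩ h ⊆ R ∧ ((P : Set Plane) ∩ h).ncard = m := by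
  obtain ⟨κ, hκ, U, hU, rfl⟩ := exists_injective_isUpperSet_preimage_eq hR
  exact exists_isHemispace_ncard_inter_eq hκ hU hm hP

end Trimming

section Coloring

variable {X : Type*} {𝓡 : Set (Set X)} {k : ℕ}

theorem isThreshold_one_one : IsThreshold 𝓡 1 1 := fun _ => ⟨fun _ => 0, fun _ _ hcard i => by
  obtain ⟨p, hp, hpR⟩ := Set.nonempty_of_ncard_ne_zero (Nat.one_le_iff_ne_zero.1 hcard)
  exact ⟨⟨p, hp⟩, hpR, Subsingleton.elim _ i⟩⟩

theorem IsThreshold.succ {f m : ℕ} (hf : IsThreshold 𝓡 k f)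
    (hm : ∀ P : Finset X, ∃ N ⊆ P, ∀ R ∈ 𝓡, m ≤ ((P : Set X) ∩ R).ncard →
      ((N : Set X) ∩ R).Nonempty ∧ f ≤ (((P : Set X) \ N) ∩ R).ncard) :
    IsThreshold 𝓡 (k + 1) m := by
  classical
  intro P
  obtain ⟨N, hNP, hN⟩ := hm P
  obtain ⟨χ, hχ⟩ := hf (P \ N)
  refine ⟨fun p => if hp : (p : X) ∈ N then Fin.last k else
    (χ ⟨p, Finset.mem_sdiff.2 ⟨p.2, hp⟩⟩).castSucc, fun R hR hcard i => ?_⟩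
  obtain ⟨⟨q, hqN, hqR⟩, hrest⟩ := hN R hR hcard
  cases i using Fin.lastCases with
  | last => exact ⟨⟨q, hNP hqN⟩, hqR, dif_pos hqN⟩
  | cast i =>
    obtain ⟨⟨p, hp⟩, hpR, rfl⟩ := hχ R hR (by rwa [Finset.coe_sdiff]) i
    obtain ⟨hpP, hpN⟩ := Finset.mem_sdiff.1 hp
    exact ⟨⟨p, hpP⟩, hpR, dif_neg hpN⟩

theorem exists_hitting_set_halfPlanes (P : Finset Plane) {m : ℕ} (hm : 1 ≤ m) :
    ∃ N ⊆ P, ∀ R ∈ halfPlanes, m ≤ ((P : Set Plane) ∩ R).ncard →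
      ((N : Set Plane) ∩ R).Nonempty ∧ m ≤ (((P : Set Plane) \ N) ∩ R).ncard + 2 := by
  obtain ⟨N, hNP, hN⟩ := exists_sparse_hitting_set finrank_euclideanSpace_fin P hm
  refine ⟨N, hNP, fun R hR hcard => ?_⟩
  obtain ⟨h, hh, hhR, hhm⟩ := exists_isHemispace_inter_subset_halfPlane hR hm hcard
  obtain ⟨p, hpN, hph⟩ := (hN h hh).1 hhm.ge
  refine ⟨⟨p, hpN, hhR ⟨hNP hpN, hph⟩⟩, ?_⟩
  calc m = ((P : Set Plane) ∩ h).ncard := hhm.symm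
    _ ≤ (((P : Set Plane) ∩ h) \ (N ∩ h)).ncard + ((N : Set Plane) ∩ h).ncard :=
      Set.ncard_le_ncard_sdiff_add_ncard _ _ (N.finite_toSet.inter_of_left h)
    _ ≤ (((P : Set Plane) \ N) ∩ R).ncard + 2 := by
      gcongr
      · exact P.finite_toSet.sdiff.inter_of_left R
      · exact fun x ⟨hx, hxN⟩ => ⟨⟨hx.1, fun hxN' => hxN ⟨hxN', hx.2⟩⟩, hhR hx⟩
      · exact (hN h hh).2 hhm

theorem isThreshold_halfPlanes : IsThreshold halfPlanes (k + 1) (2 * k + 1) := by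
  induction k with
  | zero => exact isThreshold_one_one
  | succ k ih =>
    refine ih.succ fun P => ?_
    obtain ⟨N, hNP, hN⟩ := exists_hitting_set_halfPlanes P (m := 2 * (k + 1) + 1) (by omega)
    refine ⟨N, hNP, fun R hR hcard => ?_⟩
    obtain ⟨hne, hrest⟩ := hN R hR hcard
    exact ⟨hne, by omega⟩

end Coloring

section LowerBound

theorem exists_color_forall_eq {α β : Type*} [Fintype β] (χ : α → β) {Γ : Finset α}
    (hne : Γ.Nonempty) (hΓ : Γ.card < 2 * Fintype.card β) :
    ∃ c, ∃ t ∈ Γ, ∀ p ∈ Γ, χ p = c → p = t := by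
  classical
  obtain ⟨c, -, hc⟩ := Finset.exists_card_fiber_lt_of_card_lt_mul (s := Γ) (t := Finset.univ)
    (f := χ) (n := 2) (by simpa [mul_comm] using hΓ)
  obtain hempty | ⟨t, ht⟩ := (Γ.filter (χ · = c)).eq_empty_or_nonempty
  · obtain ⟨t, ht⟩ := hne
    exact ⟨c, t, ht, fun p hp hpc => absurd hpc (Finset.filter_eq_empty_iff.1 hempty hp)⟩
  · exact ⟨c, t, (Finset.mem_filter.1 ht).1, fun p hp hpc =>
      Finset.card_le_one.1 (Nat.le_of_lt_succ hc) p (Finset.mem_filter.2 ⟨hp, hpc⟩) t ht⟩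

section Abstract

variable {X : Type*} {𝓡 : Set (Set X)} {P Γ : Finset X} {k : ℕ}

theorem exists_not_isPolychromatic (hΓP : Γ ⊆ P) (hne : Γ.Nonempty) (hΓ : Γ.card < 2 * k)
    (hcut : ∀ t ∈ Γ, ∃ R ∈ 𝓡, (P : Set X) ∩ R = (Γ : Set X) \ {t})
    (χ : {p : X // p ∈ P} → Fin k) :
    ∃ R ∈ 𝓡, (P : Set X) ∩ R ⊆ Γ ∧ ((P : Set X) ∩ R).ncard + 1 = Γ.card ∧
      ¬ IsPolychromatic χ R := by
  classical
  have hcard : (Γ.subtype (· ∈ P)).card = Γ.card := by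
    rw [Finset.card_subtype, Finset.filter_true_of_mem hΓP]
  obtain ⟨c, t, ht, hc⟩ := exists_color_forall_eq χ (Γ := Γ.subtype (· ∈ P))
    (Finset.card_pos.1 (hcard ▸ hne.card_pos)) (by simpa [hcard] using hΓ)
  have htΓ : (t : X) ∈ Γ := Finset.mem_subtype.1 ht
  obtain ⟨R, hR, hPR⟩ := hcut t htΓ
  refine ⟨R, hR, hPR.le.trans Set.sdiff_subset, ?_, fun hpoly => ?_⟩
  · rw [hPR, Set.ncard_sdiff_singleton_add_one htΓ, Set.ncard_coe_finset]
  · obtain ⟨p, hpR, hpc⟩ := hpoly c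
    obtain ⟨hpΓ, hpt⟩ := hPR.le ⟨p.2, hpR⟩
    exact hpt (congrArg Subtype.val (hc p (Finset.mem_subtype.2 hpΓ) hpc))

theorem IsThreshold.card_le {f : ℕ} (hf : IsThreshold 𝓡 k f) (hΓP : Γ ⊆ P) (hne : Γ.Nonempty)
    (hΓ : Γ.card < 2 * k) (hcut : ∀ t ∈ Γ, ∃ R ∈ 𝓡, (P : Set X) ∩ R = (Γ : Set X) \ {t}) :
    Γ.card ≤ f := by
  obtain ⟨χ, hχ⟩ := hf P
  obtain ⟨R, hR, -, hcard, hnot⟩ := exists_not_isPolychromatic hΓP hne hΓ hcut χ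
  by_contra! hlt
  exact hnot (hχ R hR (by omega))

theorem IsThreshold.anti {𝓢 : Set (Set X)} {f : ℕ} (hf : IsThreshold 𝓢 k f) (h𝓡 : 𝓡 ⊆ 𝓢) :
    IsThreshold 𝓡 k f :=
  fun P => (hf P).imp fun _ hχ R hR => hχ R (h𝓡 hR)

end Abstract

/-- The point of the parabola `y = x ^ 2` with abscissa `t`. -/
def parabolaPoint (t : ℝ) : Plane := !₂[t, t ^ 2]

/-- The open half-plane above the tangent to the parabola `y = x ^ 2` at abscissa `t`: by strict
convexity it contains every other point of the parabola. -/
def aboveTangent (t : ℝ) : Set Plane := {x | 2 * t * x 0 - t ^ 2 < x 1}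

theorem parabolaPoint_injective : Function.Injective parabolaPoint := fun s t hst => by
  simpa [parabolaPoint] using congrArg (fun x : Plane => x 0) hst

theorem aboveTangent_mem_openHalfPlanes (t : ℝ) : aboveTangent t ∈ openHalfPlanes := by
  refine ⟨!₂[-2 * t, 1], -t ^ 2, fun h => ?_, Set.ext fun x => ?_⟩
  · simpa using congrArg (fun v : Plane => v 1) h
  · have hinner : inner ℝ !₂[-2 * t, 1] x = x 1 - 2 * t * x 0 := by
      simp [PiLp.inner_apply, Fin.sum_univ_two]
      ring
    simp only [aboveTangent, Set.mem_ofPred_eq, hinner]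
    constructor <;> intro h <;> linarith

theorem parabolaPoint_mem_aboveTangent {s t : ℝ} : parabolaPoint s ∈ aboveTangent t ↔ s ≠ t := by
  rw [← sub_ne_zero, ← sq_pos_iff]
  simp only [parabolaPoint, aboveTangent, Set.mem_ofPred_eq, Matrix.cons_val_zero,
    Matrix.cons_val_one]
  constructor <;> intro h <;> linarith

theorem notMem_aboveTangent_of_le_neg_one {t y : ℝ} (ht : t ∈ Set.Ioo (-1) 1) (hy : y ≤ -1) :
    (!₂[0, y] : Plane) ∉ aboveTangent t := by
  have : t ^ 2 < 1 := (sq_lt_one_iff_abs_lt_one t).2 (abs_lt.2 ht)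
  suffices y ≤ -t ^ 2 by simpa [aboveTangent]
  linarith

theorem inter_aboveTangent_eq {A B : Set ℝ} {t : ℝ} (hB : B ⊆ Set.Iic (-1))
    (ht : t ∈ Set.Ioo (-1) 1) :
    (parabolaPoint '' A ∪ (fun y => !₂[0, y]) '' B) ∩ aboveTangent t =
      parabolaPoint '' A \ {parabolaPoint t} := by
  have hbelow : Disjoint ((fun y => (!₂[0, y] : Plane)) '' B) (aboveTangent t) := by
    rw [Set.disjoint_left, Set.forall_mem_image]
    exact fun y hy => notMem_aboveTangent_of_le_neg_one ht (hB hy)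
  rw [Set.union_inter_distrib_right, hbelow.inter_eq, Set.union_empty]
  ext p
  refine and_congr_right ?_
  rintro ⟨s, -, rfl⟩
  rw [parabolaPoint_mem_aboveTangent, Set.mem_singleton_iff, parabolaPoint_injective.eq_iff]

theorem exists_finset_parabola_cut {m n : ℕ} (hmn : m ≤ n) :
    ∃ P Γ : Finset Plane, P.card = n ∧ Γ ⊆ P ∧ Γ.card = m ∧
      (∀ p ∈ Γ, p 1 = (p 0) ^ 2 ∧ -1 < p 0 ∧ p 0 < 1) ∧
      ∀ t ∈ Γ, ∃ h ∈ openHalfPlanes, (P : Set Plane) ∩ h = (Γ : Set Plane) \ {t} := by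
  classical
  have hlt : (-1 : ℝ) < 1 := by norm_num
  obtain ⟨A, hA, hAcard⟩ := (Set.Ioo_infinite hlt).exists_subset_card_eq m
  obtain ⟨B, hB, hBcard⟩ := (Set.Iic_infinite (-1 : ℝ)).exists_subset_card_eq (n - m)
  let Γ := A.image parabolaPoint
  let D := B.image fun y => (!₂[0, y] : Plane)
  have hD : Function.Injective fun y : ℝ => (!₂[0, y] : Plane) := fun y z h => by
    simpa using congrArg (fun x : Plane => x 1) h
  have hdisj : Disjoint Γ D := by
    simp only [Γ, D, Finset.disjoint_left, Finset.mem_image, not_exists, not_and]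
    rintro _ ⟨t, -, rfl⟩ y hy hyt
    have hyt1 : y = t ^ 2 := by simpa [parabolaPoint] using congrArg (fun x : Plane => x 1) hyt
    linarith [sq_nonneg t, Set.mem_Iic.1 (hB hy)]
  have hΓcard : Γ.card = m := by
    rw [Finset.card_image_of_injective _ parabolaPoint_injective, hAcard]
  refine ⟨Γ ∪ D, Γ, ?_, Finset.subset_union_left, hΓcard, ?_, ?_⟩
  · rw [Finset.card_union_of_disjoint hdisj, hΓcard, Finset.card_image_of_injective _ hD, hBcard]
    omega
  · intro p hp
    obtain ⟨t, ht, rfl⟩ := Finset.mem_image.1 hp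
    exact ⟨by simp [parabolaPoint], hA ht⟩
  · intro p hp
    obtain ⟨t, ht, rfl⟩ := Finset.mem_image.1 hp
    refine ⟨aboveTangent t, aboveTangent_mem_openHalfPlanes t, ?_⟩
    simpa only [Γ, D, Finset.coe_union, Finset.coe_image] using inter_aboveTangent_eq hB (hA ht)

end LowerBound

end PolychromaticColoring

open PolychromaticColoring in
theorem theorem1 (k : ℕ) (hk : 1 ≤ k) :
    PolychromaticNumberEq halfPlanes k (2 * k - 1) ∧
    ∀ n : ℕ, 2 * k - 1 ≤ n →
      ∃ P Γ : Finset Plane, P.card = n ∧ Γ ⊆ P ∧ Γ.card = 2 * k - 1 ∧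
        (∀ p ∈ Γ, p 1 = (p 0) ^ 2 ∧ -1 < p 0 ∧ p 0 < 1) ∧
        ∀ χ : {p : Plane // p ∈ P} → Fin k,
          ∃ h ∈ openHalfPlanes, (P : Set Plane) ∩ h ⊆ (Γ : Set Plane) ∧
            ((P : Set Plane) ∩ h).ncard = 2 * k - 2 ∧ ¬ IsPolychromatic χ h := by
  refine ⟨⟨?_, fun f hf => ?_⟩, fun n hn => ?_⟩
  · obtain ⟨k, rfl⟩ := Nat.exists_eq_add_of_le' hk
    exact isThreshold_halfPlanes
  · obtain ⟨P, Γ, -, hΓP, hΓcard, -, hcut⟩ := exists_finset_parabola_cut (le_refl (2 * k - 1))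
    exact hΓcard.ge.trans ((hf.anti Set.subset_union_left).card_le hΓP
      (Finset.card_pos.1 (by omega)) (by omega) hcut)
  · obtain ⟨P, Γ, hP, hΓP, hΓcard, hΓ, hcut⟩ := exists_finset_parabola_cut hn
    refine ⟨P, Γ, hP, hΓP, hΓcard, hΓ, fun χ => ?_⟩
    obtain ⟨h, hh, hsub, hcard, hχ⟩ :=
      exists_not_isPolychromatic hΓP (Finset.card_pos.1 (by omega)) (by omega) hcut χ
    exact ⟨h, hh, hsub, by omega, hχ⟩
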